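/- Let $e_1,e_2,\dots$ be a stream of edges of a bipartite graph with parts $L$ and $R$ (each $e_i\in L\times R$), in an arbitrary order, and let $t\ge 0$ be such that $e_1,\dots,e_t$ are pairwise distinct. Let $G^{(t)}$ be the graph with edge set $\{e_1,\dots,e_t\}$. A butterfly is a $2\times2$ biclique: two vertices $a\ne b$ in $L$ and two vertices $x\ne y$ in $R$ with all four edges $(a,x),(a,y),(b,x),(b,y)$ present. Let $B$ be the number of butterflies in $G^{(t)}$, and let $h$ be the maximum number of butterflies of $G^{(t)}$ that one edge is part of. Assume $B>0$. The algorithm ADA with reservoir size $M\in\mathbb N$ and resampling parameter $\gamma$ keeps a sampling probability $p$ (initially $1$), a set $\mathcal R$ of edges (initially empty) and an estimate $\beta$ (initially $0$). On arrival of each edge $e$ it does the following. While $|\mathcal R|\ge M$: set $p\leftarrow\gamma p$, keep each edge of $\mathcal R$ with probability $\gamma$ and discard it with probability $1-\gamma$, independently, and set $\beta\leftarrow p^{-4}\cdot(\text{number of butterflies in }\mathcal R)$. Then, with probability $p$, set $\mathcal R\leftarrow\mathcal R\cup\{e\}$ and $\beta\leftarrow\beta+p^{-4}\cdot(\text{number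 of butterflies in }\mathcal R\text{ that contain }e)$. All coins are independent. Let $Y^{(t)}$ be the value of $\beta$ after the first $t$ edges. Let $\tfrac12\le\gamma\le 0.9$ and $\varepsilon,\delta\in(0,1)$. If $$M\;\ge\;6t\cdot\Bigl(\frac{12h}{\varepsilon^2B}\,\ln\frac{8h(4+\delta)}{\delta}\Bigr)^{1/4},$$ then $$\Pr\bigl[\,|Y^{(t)}-B|\ge\varepsilon B\,\bigr]\le\delta,$$ where a run of ADA that never finishes processing the first $t$ edges is counted in the event on the left. -/

import Mathlib

open scoped unitInterval ENNReal NNReal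

noncomputable section

namespace Fleet

/-! ### Probabilistic programs -/

/-- The coin `flip(p)`: heads (`true`) with probability `p`, tails with probability `1 - p`. -/
def coinFlip (p : I) : PMF Bool :=
  PMF.ofFintype
    (fun b => cond b (unitInterval.toNNReal p : ℝ≥0∞) (unitInterval.toNNReal (σ p) : ℝ≥0∞)) (by
      rw [Fintype.sum_bool, cond_true, cond_false, ← ENNReal.coe_add,
        unitInterval.toNNReal_add_toNNReal_symm, ENNReal.coe_one])

/-- The random subset of `S` in which every element of `S` is kept with probability `q` and
discarded with probability `1 - q`, independently of the others: the outcome `A ⊆ S` has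
probability `q ^ |A| * (1 - q) ^ (|S| - |A|)`. -/
def subsample {α : Type*} [DecidableEq α] (q : I) (S : Finset α) : PMF (Finset α) :=
  PMF.ofFinset
    (fun A => if A ⊆ S then (unitInterval.toNNReal q : ℝ≥0∞) ^ A.card *
      (unitInterval.toNNReal (σ q) : ℝ≥0∞) ^ (S.card - A.card) else 0)
    S.powerset
    (by
      rw [Finset.sum_congr rfl (fun A hA => if_pos (Finset.mem_powerset.1 hA)),
        Finset.sum_pow_mul_eq_add_pow, ← ENNReal.coe_add,
        unitInterval.toNNReal_add_toNNReal_symm, ENNReal.coe_one, one_pow])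
    (fun A hA => if_neg (fun h => hA (Finset.mem_powerset.2 h)))

/-- `while c do body`, started in `a` and cut off after `n` executions of the body; the outcome
`none` means that the loop has not ended by then. -/
def whileFuel {α : Type*} (c : α → Prop) [DecidablePred c] (body : α → PMF α) :
    ℕ → α → PMF (Option α)
  | 0, a => if c a then PMF.pure none else PMF.pure (some a)
  | n + 1, a => if c a then (body a).bind (whileFuel c body n) else PMF.pure (some a)

theorem whileFuel_le_succ {α : Type*} (c : α → Prop) [DecidablePred c] (body : α → PMF α)
    (b : α) (n : ℕ) (a : α) :
    whileFuel c body n a (some b) ≤ whileFuel c body (n + 1) a (some b) := by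
  induction n generalizing a with
  | zero =>
    by_cases h : c a
    · simp [whileFuel, h]
    · simp [whileFuel, h]
  | succ n ih =>
    by_cases h : c a
    · rw [whileFuel, whileFuel, if_pos h, if_pos h, PMF.bind_apply, PMF.bind_apply]
      exact ENNReal.tsum_le_tsum fun x => mul_le_mul_right (ih x) _
    · simp [whileFuel, h]

theorem tsum_iSup_whileFuel_le_one {α : Type*} (c : α → Prop) [DecidablePred c]
    (body : α → PMF α) (a : α) : ∑' b, ⨆ n, whileFuel c body n a (some b) ≤ 1 := by
  rw [ENNReal.tsum_eq_iSup_sum]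
  refine iSup_le fun s => ?_
  rw [ENNReal.finsetSum_iSup_of_monotone
    (fun b => monotone_nat_of_le_succ fun n => whileFuel_le_succ c body b n a)]
  refine iSup_le fun n => ?_
  calc ∑ b ∈ s, whileFuel c body n a (some b)
      = ∑ o ∈ s.map Function.Embedding.some, whileFuel c body n a o := by
        rw [Finset.sum_map]; rfl
    _ ≤ ∑' o, whileFuel c body n a o := ENNReal.sum_le_tsum _
    _ = 1 := PMF.tsum_coe _

/-- `while c do body` started in `a`. The outcome `some b` means that the loop ends in `b`: its
probability is the limit of the probabilities that the loop ends in `b` after at most `n`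
executions of the body. The outcome `none` means that the loop runs forever; it has the
remaining probability. -/
def whileLoop {α : Type*} (c : α → Prop) [DecidablePred c] (body : α → PMF α) (a : α) :
    PMF (Option α) :=
  ⟨fun o => match o with
    | none => 1 - ∑' b, ⨆ n, whileFuel c body n a (some b)
    | some b => ⨆ n, whileFuel c body n a (some b), by
    rw [← (Equiv.optionEquivSumPUnit.{0} α).symm.hasSum_iff]
    have key := add_tsub_cancel_of_le (tsum_iSup_whileFuel_le_one c body a)
    refine Eq.subst (motive := HasSum _) key ?_
    exact HasSum.sum ENNReal.summable.hasSum (hasSum_unique _)⟩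

/-! ### Butterflies in bipartite graphs

A bipartite graph with parts `L` and `R` is given by its finite edge set `E ⊆ L × R`. -/

/-- The butterflies of `E`: a butterfly is a pair `({a, b}, {x, y})` of two left and two right
vertices such that all of `(a, x), (a, y), (b, x), (b, y)` are edges. -/
def butterflies {L R : Type*} [DecidableEq L] [DecidableEq R] (E : Finset (L × R)) :
    Finset (Finset L × Finset R) :=
  ((E.image Prod.fst).powersetCard 2 ×ˢ (E.image Prod.snd).powersetCard 2).filter
    (fun w => w.1 ×ˢ w.2 ⊆ E)

/-- The number of butterflies of `E`. -/
def numButterflies {L R : Type*} [DecidableEq L] [DecidableEq R] (E : Finset (L × R)) : ℕ :=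
  (butterflies E).card

/-- The number of butterflies of `E` that contain the edge `e`. -/
def butterfliesPerEdge {L R : Type*} [DecidableEq L] [DecidableEq R] (e : L × R)
    (E : Finset (L × R)) : ℕ :=
  ((butterflies E).filter (fun w => e ∈ w.1 ×ˢ w.2)).card

/-- The maximum number of butterflies of `E` that one edge of `E` can be part of. -/
def maxButterfliesPerEdge {L R : Type*} [DecidableEq L] [DecidableEq R]
    (E : Finset (L × R)) : ℕ :=
  E.sup (fun e => butterfliesPerEdge e E)

/-- The graph formed by the first `t` edges `e 0, …, e (t - 1)` of the stream `e`. -/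
def streamGraph {L R : Type*} [DecidableEq L] [DecidableEq R] (e : ℕ → L × R) (t : ℕ) :
    Finset (L × R) :=
  (Finset.range t).image e

/-! ### The algorithm ADA (adaptive sampling) -/

/-- The variables of ADA: sampling probability `p`, reservoir, and current estimate `β`. -/
structure AdaState (L R : Type*) where
  p : I
  reservoir : Finset (L × R)
  β : ℝ

/-- Initially `p = 1`, the reservoir is empty and `β = 0`. -/
def adaInit (L R : Type*) : AdaState L R := ⟨1, ∅, 0⟩

/-- The body of the while loop: `p ← γ p`; keep each edge of the reservoir with probability `γ`;
recompute `β ← p⁻⁴ ·` (number of butterflies in the reservoir). -/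
def adaResample {L R : Type*} [DecidableEq L] [DecidableEq R] (γ : I) (s : AdaState L R) :
    PMF (AdaState L R) :=
  (subsample γ s.reservoir).map fun S =>
    ⟨γ * s.p, S, (((γ * s.p : I) : ℝ) ^ 4)⁻¹ * (numButterflies S : ℝ)⟩

/-- Add the edge `e` to the reservoir and update
`β ← β + p⁻⁴ ·` (number of butterflies in the reservoir that contain `e`). -/
def adaInsert {L R : Type*} [DecidableEq L] [DecidableEq R] (s : AdaState L R) (e : L × R) :
    AdaState L R :=
  ⟨s.p, insert e s.reservoir,
    s.β + ((s.p : ℝ) ^ 4)⁻¹ * (butterfliesPerEdge e (insert e s.reservoir) : ℝ)⟩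

/-- Processing of one edge `e`: while the reservoir holds at least `M` edges, resample; then insert
`e` if `flip(p)` shows heads. The outcome `none` stands for non-termination. -/
def adaStep {L R : Type*} [DecidableEq L] [DecidableEq R] (M : ℕ) (γ : I) (e : L × R)
    (s : AdaState L R) : PMF (Option (AdaState L R)) :=
  (whileLoop (fun s' : AdaState L R => M ≤ s'.reservoir.card) (adaResample γ) s).bind fun o =>
    match o with
    | none => PMF.pure none
    | some s' => (coinFlip s'.p).map fun heads => some (if heads then adaInsert s' e else s')

/-- The random state of ADA after the first `t` edges of the stream. -/
def adaRun {L R : Type*} [DecidableEq L] [DecidableEq R] (M : ℕ) (γ : I) (e : ℕ → L × R) :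
    ℕ → PMF (Option (AdaState L R))
  | 0 => PMF.pure (some (adaInit L R))
  | t + 1 => (adaRun M γ e t).bind fun o =>
    match o with
    | none => PMF.pure none
    | some s => adaStep M γ (e t) s

/-- The random estimate that ADA returns after the first `t` edges of the stream
(`none` if ADA does not terminate). -/
def adaEstimate {L R : Type*} [DecidableEq L] [DecidableEq R] (M : ℕ) (γ : I) (e : ℕ → L × R)
    (t : ℕ) : PMF (Option ℝ) :=
  (adaRun M γ e t).map (Option.map AdaState.β)

end Fleet

end

noncomputable section

namespace Fleet

/-! ### Expectations over random subsets -/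

/-! Say that ADA is at level `k` when its sampling probability is `γ ^ k`. Since the edges are
distinct, the estimate is always `γ ^ (-4k)` times the number of butterflies in the reservoir. The
final level depends on the coins, so the final reservoir is not a plain Bernoulli sample. This is
handled by a union bound over levels in the form of a supermartingale, `failureBound`: for each
level `K ≤ N`, the conditional probability that the sample at rate `γ ^ K` (thin the present
reservoir, sample the coming edges) gives a bad estimate, plus the conditional probability that the
sample at level `N` has at least `M` edges. Insertions preserve the sum, resampling does not
increase it, and failure, including non-termination, forces it to be at least `1`. Its initial
value, which only involves plain Bernoulli samples, therefore bounds the failure probability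
(`adaEstimate_deviation_le`).

For a plain sample at rate `q`, butterflies are dependent only through shared edges, and each shares
an edge with fewer than `4h` others. A greedy colouring splits them into `4h` edge-disjoint classes;
Jensen's inequality combines the classes into a Chernoff bound `2 exp(-ε² B q⁴ / (12h))`
(`bernoulliExp_deviates_le`).

Let `l` be the logarithm in the hypothesis and `P⁴ = 12 h l / (ε² B)`. If `P < 1`, let `N` be the
last level of rate at least `P`. The deviation bounds shrink geometrically from level `N` down to
level `0` and sum to at most `4 exp(-l)`; overflow at level `N` costs at most `exp(-l)`, as `M ≥
6tP` while the mean sample size is at most `2tP` (`sampling_failure_le`). If `P ≥ 1`, nothing is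
ever discarded. -/

/-- The expectation of `g A` for the random subset `A` of `S` that contains every element of `S`
independently with probability `q`. -/
def bernoulliExp {α : Type*} (q : ℝ) (S : Finset α) (g : Finset α → ℝ) : ℝ :=
  ∑ A ∈ S.powerset, q ^ A.card * (1 - q) ^ (S.card - A.card) * g A

section BernoulliExp

variable {α : Type*}

theorem bernoulliExp_congr {q : ℝ} {S : Finset α} {f g : Finset α → ℝ}
    (h : ∀ A ⊆ S, f A = g A) : bernoulliExp q S f = bernoulliExp q S g :=
  Finset.sum_congr rfl fun A hA => by rw [h A (Finset.mem_powerset.1 hA)]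

theorem bernoulliExp_mono {q : ℝ} (h0 : 0 ≤ q) (h1 : q ≤ 1) {S : Finset α} {f g : Finset α → ℝ}
    (h : ∀ A ⊆ S, f A ≤ g A) : bernoulliExp q S f ≤ bernoulliExp q S g :=
  Finset.sum_le_sum fun A hA => mul_le_mul_of_nonneg_left (h A (Finset.mem_powerset.1 hA))
    (mul_nonneg (pow_nonneg h0 _) (pow_nonneg (sub_nonneg.2 h1) _))

theorem bernoulliExp_const (q : ℝ) (S : Finset α) (c : ℝ) :
    bernoulliExp q S (fun _ => c) = c := by
  rw [bernoulliExp, ← Finset.sum_mul, Finset.sum_pow_mul_eq_add_pow]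
  simp

theorem bernoulliExp_nonneg {q : ℝ} (h0 : 0 ≤ q) (h1 : q ≤ 1) {S : Finset α}
    {g : Finset α → ℝ} (h : ∀ A, 0 ≤ g A) : 0 ≤ bernoulliExp q S g := by
  rw [← bernoulliExp_const q S 0]
  exact bernoulliExp_mono h0 h1 fun A _ => h A

theorem bernoulliExp_add (q : ℝ) (S : Finset α) (f g : Finset α → ℝ) :
    bernoulliExp q S (fun A => f A + g A) = bernoulliExp q S f + bernoulliExp q S g := by
  simp only [bernoulliExp, mul_add, Finset.sum_add_distrib]

theorem bernoulliExp_const_mul (q : ℝ) (S : Finset α) (c : ℝ) (g : Finset α → ℝ) :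
    bernoulliExp q S (fun A => c * g A) = c * bernoulliExp q S g := by
  simp only [bernoulliExp, Finset.mul_sum]
  exact Finset.sum_congr rfl fun A _ => by ring

theorem bernoulliExp_sum {ι : Type*} (q : ℝ) (S : Finset α) (J : Finset ι)
    (g : ι → Finset α → ℝ) :
    bernoulliExp q S (fun A => ∑ j ∈ J, g j A) = ∑ j ∈ J, bernoulliExp q S (g j) := by
  simp only [bernoulliExp, Finset.mul_sum]
  exact Finset.sum_comm

theorem bernoulliExp_empty (q : ℝ) (g : Finset α → ℝ) : bernoulliExp q ∅ g = g ∅ := by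
  simp [bernoulliExp]

theorem bernoulliExp_one (S : Finset α) (g : Finset α → ℝ) : bernoulliExp 1 S g = g S := by
  rw [bernoulliExp, Finset.sum_eq_single S]
  · simp
  · intro A hA hne
    have : A.card < S.card :=
      Finset.card_lt_card ((Finset.mem_powerset.1 hA).ssubset_of_ne hne)
    have h : S.card - A.card ≠ 0 := by omega
    simp [h]
  · simp

theorem bernoulliExp_pow_card (q c : ℝ) (S : Finset α) :
    bernoulliExp q S (fun A => c ^ A.card) = (1 + (c - 1) * q) ^ S.card := by
  have : ∀ A ∈ S.powerset, q ^ A.card * (1 - q) ^ (S.card - A.card) * c ^ A.card =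
      (q * c) ^ A.card * (1 - q) ^ (S.card - A.card) := fun A _ => by rw [mul_pow]; ring
  rw [bernoulliExp, Finset.sum_congr rfl this, Finset.sum_pow_mul_eq_add_pow]
  ring

variable [DecidableEq α]

theorem bernoulliExp_insert (q : ℝ) {S : Finset α} {e : α} (he : e ∉ S) (g : Finset α → ℝ) :
    bernoulliExp q (insert e S) g =
      q * bernoulliExp q S (fun A => g (insert e A)) + (1 - q) * bernoulliExp q S g := by
  rw [bernoulliExp, Finset.sum_powerset_insert he, add_comm, bernoulliExp, bernoulliExp,
    Finset.mul_sum, Finset.mul_sum]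
  congr 1 <;> refine Finset.sum_congr rfl fun A hA => ?_
  · rw [Finset.mem_powerset] at hA
    rw [Finset.card_insert_of_notMem he, Finset.card_insert_of_notMem (fun h => he (hA h)),
      Nat.add_sub_add_right]
    ring
  · have := Finset.card_le_card (Finset.mem_powerset.1 hA)
    rw [Finset.card_insert_of_notMem he, Nat.succ_sub this,
      pow_succ]
    ring

/-- Thinning a random subset with rate `q` by another factor `r` gives rate `q * r`. -/
theorem bernoulliExp_bernoulliExp (q r : ℝ) (S : Finset α) (g : Finset α → ℝ) :
    bernoulliExp q S (fun A => bernoulliExp r A g) = bernoulliExp (q * r) S g := by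
  induction S using Finset.induction_on generalizing g with
  | empty => simp only [bernoulliExp_empty]
  | insert e S he ih =>
    rw [bernoulliExp_insert _ he, bernoulliExp_insert _ he, ih,
      bernoulliExp_congr (fun A hA => bernoulliExp_insert r (fun h => he (hA h)) g),
      bernoulliExp_add, bernoulliExp_const_mul, bernoulliExp_const_mul, ih, ih]
    ring

theorem bernoulliExp_subset_indicator (q : ℝ) {S W : Finset α} (hW : W ⊆ S) :
    bernoulliExp q S (fun A => if W ⊆ A then 1 else 0) = q ^ W.card := by
  induction S using Finset.induction_on generalizing W with
  | empty => simp [bernoulliExp_empty, Finset.subset_empty.1 hW]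
  | insert e S he ih =>
    rw [bernoulliExp_insert _ he]
    by_cases h : e ∈ W
    · have h1 : W.erase e ⊆ S := Finset.subset_insert_iff.1 hW
      have h2 : bernoulliExp q S (fun A => if W ⊆ A then (1 : ℝ) else 0) = 0 := by
        refine (bernoulliExp_congr fun A hA => ?_).trans (bernoulliExp_const q S 0)
        exact if_neg fun hw => he (hA (hw h))
      simp only [Finset.subset_insert_iff]
      rw [ih h1, h2, Finset.card_erase_of_mem h]
      have := Finset.card_pos.2 ⟨e, h⟩
      rw [mul_zero, add_zero, ← pow_succ', Nat.sub_add_cancel this]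
    · have h1 : W ⊆ S := (Finset.subset_insert_iff_of_notMem h).1 hW
      simp only [Finset.subset_insert_iff_of_notMem h]
      rw [ih h1]
      ring

end BernoulliExp

/-! ### Expectations with respect to a probability mass function -/

/-- The expectation of an extended nonnegative function. -/
def pmfExp {α : Type*} (p : PMF α) (f : α → ℝ≥0∞) : ℝ≥0∞ := ∑' x, p x * f x

section PmfExp

variable {α β : Type*}

theorem pmfExp_mono (p : PMF α) {f g : α → ℝ≥0∞} (h : ∀ x, f x ≤ g x) :
    pmfExp p f ≤ pmfExp p g :=
  ENNReal.tsum_le_tsum fun x => mul_le_mul_right (h x) _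

theorem pmfExp_pure (a : α) (f : α → ℝ≥0∞) : pmfExp (PMF.pure a) f = f a := by
  rw [pmfExp, tsum_eq_single a]
  · simp
  · intro b hb
    simp [PMF.pure_apply, hb]

theorem pmfExp_bind (p : PMF α) (q : α → PMF β) (f : β → ℝ≥0∞) :
    pmfExp (p.bind q) f = pmfExp p (fun a => pmfExp (q a) f) := by
  simp only [pmfExp, PMF.bind_apply, ← ENNReal.tsum_mul_left, ← ENNReal.tsum_mul_right]
  rw [ENNReal.tsum_comm]
  simp only [mul_assoc]

theorem pmfExp_map (p : PMF α) (q : α → β) (f : β → ℝ≥0∞) :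
    pmfExp (p.map q) f = pmfExp p (fun a => f (q a)) := by
  rw [PMF.map, pmfExp_bind]
  simp only [Function.comp, pmfExp_pure]

theorem tsum_option_eq_add (f : Option α → ℝ≥0∞) : ∑' o, f o = f none + ∑' a, f (some a) := by
  rw [← (Equiv.optionEquivSumPUnit.{0} α).symm.tsum_eq,
    ENNReal.summable.tsum_sum ENNReal.summable, add_comm]
  simp

theorem toOuterMeasure_le_pmfExp (p : PMF α) (s : Set α) {f : α → ℝ≥0∞}
    (h : ∀ x ∈ s, 1 ≤ f x) : p.toOuterMeasure s ≤ pmfExp p f := by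
  rw [PMF.toOuterMeasure_apply]
  refine ENNReal.tsum_le_tsum fun x => ?_
  by_cases hx : x ∈ s
  · rw [Set.indicator_of_mem hx]
    exact le_mul_of_one_le_right' (h x hx)
  · rw [Set.indicator_of_notMem hx]
    exact zero_le

theorem coe_toNNReal_eq_ofReal (q : I) :
    ((unitInterval.toNNReal q : ℝ≥0) : ℝ≥0∞) = ENNReal.ofReal q := by
  rw [ENNReal.ofReal, Real.toNNReal_of_nonneg q.2.1]
  rfl

theorem pmfExp_coinFlip (q : I) (f : Bool → ℝ≥0∞) :
    pmfExp (coinFlip q) f =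
      ENNReal.ofReal q * f true + ENNReal.ofReal (1 - (q : ℝ)) * f false := by
  rw [pmfExp, tsum_fintype, Fintype.sum_bool]
  simp only [coinFlip, PMF.ofFintype_apply, cond_true, cond_false, coe_toNNReal_eq_ofReal,
    unitInterval.coe_symm_eq]

theorem pmfExp_subsample_le [DecidableEq α] (q : I) (S : Finset α) {f : Finset α → ℝ≥0∞}
    {g : Finset α → ℝ} (hg : ∀ A, 0 ≤ g A) (h : ∀ A ⊆ S, f A ≤ ENNReal.ofReal (g A)) :
    pmfExp (subsample q S) f ≤ ENNReal.ofReal (bernoulliExp q S g) := by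
  have hq : 0 ≤ 1 - (q : ℝ) := sub_nonneg.2 q.2.2
  have hw : ∀ A : Finset α, 0 ≤ (q : ℝ) ^ A.card * (1 - (q : ℝ)) ^ (S.card - A.card) :=
    fun A => mul_nonneg (pow_nonneg q.2.1 _) (pow_nonneg hq _)
  rw [pmfExp, tsum_eq_sum (s := S.powerset), bernoulliExp,
    ENNReal.ofReal_sum_of_nonneg fun A _ => mul_nonneg (hw A) (hg A)]
  · refine Finset.sum_le_sum fun A hA => ?_
    rw [Finset.mem_powerset] at hA
    rw [subsample, PMF.ofFinset_apply, if_pos hA, coe_toNNReal_eq_ofReal, coe_toNNReal_eq_ofReal,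
      unitInterval.coe_symm_eq, ENNReal.ofReal_mul (hw A),
      ENNReal.ofReal_mul (pow_nonneg q.2.1 _), ENNReal.ofReal_pow q.2.1, ENNReal.ofReal_pow hq]
    exact mul_le_mul_right (h A hA) _
  · intro A hA
    rw [Finset.mem_powerset] at hA
    rw [subsample, PMF.ofFinset_apply, if_neg hA, zero_mul]

/-- A bound on an expectation that holds for every sufficiently large cut-off of a loop holds for
the loop itself. -/
theorem pmfExp_whileLoop_le (c : α → Prop) [DecidablePred c] (body : α → PMF α) (a : α)
    (f : Option α → ℝ≥0∞) {C : ℝ≥0∞} {N : ℕ}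
    (h : ∀ n, N ≤ n → pmfExp (whileFuel c body n a) f ≤ C) :
    pmfExp (whileLoop c body a) f ≤ C := by
  have split : ∀ p : PMF (Option α), pmfExp p f = p none * f none + ∑' b, p (some b) * f (some b) :=
    fun p => tsum_option_eq_add _
  have hmono : Monotone fun (n : ℕ) (b : α) => whileFuel c body n a (some b) :=
    monotone_nat_of_le_succ fun n b => whileFuel_le_succ c body b n a
  have hnone : ∀ n, whileLoop c body a none ≤ whileFuel c body n a none := by
    intro n
    have h1 : whileFuel c body n a none + ∑' b, whileFuel c body n a (some b) = 1 := by
      rw [← tsum_option_eq_add _]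
      exact PMF.tsum_coe _
    change 1 - ∑' b, ⨆ n, whileFuel c body n a (some b) ≤ _
    rw [tsub_le_iff_right, ← h1]
    gcongr with b
    exact le_iSup (fun n => whileFuel c body n a (some b)) n
  rw [split]
  have hsome : ∑' b, whileLoop c body a (some b) * f (some b) =
      ⨆ n, ∑' b, whileFuel c body n a (some b) * f (some b) := by
    change ∑' b, (⨆ n, whileFuel c body n a (some b)) * f (some b) = _
    simp only [ENNReal.iSup_mul]
    rw [ENNReal.tsum_eq_iSup_sum]
    simp only [ENNReal.tsum_eq_iSup_sum]
    rw [iSup_comm]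
    refine iSup_congr fun s => ?_
    exact ENNReal.finsetSum_iSup_of_monotone
      fun b m n hmn => mul_le_mul_left (hmono hmn b) _
  rw [hsome, ENNReal.add_iSup]
  refine iSup_le fun n => ?_
  -- Both parts pass to the cut-off `max N n`: the loop gives `none` at most the mass that any
  -- cut-off gives it, and the mass of `some b` grows with the cut-off.
  refine le_trans ?_ (h (max N n) (le_max_left _ _))
  rw [split]
  gcongr with b
  · exact hnone _
  · exact hmono (le_max_right N n) b

end PmfExp

/-! ### Butterflies -/

section Butterflies

variable {L R : Type*} [DecidableEq L] [DecidableEq R]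

theorem mem_butterflies {E : Finset (L × R)} {w : Finset L × Finset R} :
    w ∈ butterflies E ↔ w.1.card = 2 ∧ w.2.card = 2 ∧ w.1 ×ˢ w.2 ⊆ E := by
  simp only [butterflies, Finset.mem_filter, Finset.mem_product, Finset.mem_powersetCard]
  constructor
  · rintro ⟨⟨⟨_, h1⟩, _, h2⟩, h3⟩
    exact ⟨h1, h2, h3⟩
  · rintro ⟨h1, h2, h3⟩
    obtain ⟨a, ha⟩ : w.1.Nonempty := Finset.card_pos.1 (by omega)
    obtain ⟨x, hx⟩ : w.2.Nonempty := Finset.card_pos.1 (by omega)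
    exact ⟨⟨⟨fun b hb => Finset.mem_image.2 ⟨(b, x), h3 (Finset.mk_mem_product hb hx), rfl⟩, h1⟩,
      fun y hy => Finset.mem_image.2 ⟨(a, y), h3 (Finset.mk_mem_product ha hy), rfl⟩, h2⟩, h3⟩

/-- The four edges of a butterfly. -/
def butterflyEdges (w : Finset L × Finset R) : Finset (L × R) := w.1 ×ˢ w.2

theorem card_butterflyEdges {E : Finset (L × R)} {w : Finset L × Finset R}
    (hw : w ∈ butterflies E) : (butterflyEdges w).card = 4 := by
  obtain ⟨h1, h2, _⟩ := mem_butterflies.1 hw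
  rw [butterflyEdges, Finset.card_product, h1, h2]

theorem butterflyEdges_subset {E : Finset (L × R)} {w : Finset L × Finset R}
    (hw : w ∈ butterflies E) : butterflyEdges w ⊆ E :=
  (mem_butterflies.1 hw).2.2

theorem butterflies_of_subset {A E : Finset (L × R)} (h : A ⊆ E) :
    butterflies A = (butterflies E).filter (fun w => butterflyEdges w ⊆ A) := by
  ext w
  rw [Finset.mem_filter, mem_butterflies, mem_butterflies, butterflyEdges]
  exact ⟨fun ⟨h1, h2, h3⟩ => ⟨⟨h1, h2, h3.trans h⟩, h3⟩, fun ⟨⟨h1, h2, _⟩, h3⟩ => ⟨h1, h2, h3⟩⟩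

theorem numButterflies_insert {e : L × R} {S : Finset (L × R)} (he : e ∉ S) :
    numButterflies (insert e S) =
      numButterflies S + butterfliesPerEdge e (insert e S) := by
  rw [numButterflies, numButterflies, butterfliesPerEdge,
    butterflies_of_subset (Finset.subset_insert e S), add_comm,
    ← Finset.card_filter_add_card_filter_not (fun w => e ∈ w.1 ×ˢ w.2)]
  congr 2
  refine Finset.filter_congr fun w hw => ?_
  have hs := butterflyEdges_subset hw
  constructor
  · exact fun h => (Finset.subset_insert_iff_of_notMem h).1 hs
  · exact fun h h' => he (h h')

theorem butterfliesPerEdge_le {e : L × R} {E : Finset (L × R)} (he : e ∈ E) :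
    butterfliesPerEdge e E ≤ maxButterfliesPerEdge E :=
  Finset.le_sup (f := fun e => butterfliesPerEdge e E) he

theorem numButterflies_le (E : Finset (L × R)) :
    numButterflies E ≤ E.card * maxButterfliesPerEdge E := by
  have h : butterflies E ⊆ E.biUnion
      (fun e => (butterflies E).filter (fun w => e ∈ w.1 ×ˢ w.2)) := by
    intro w hw
    obtain ⟨e, he⟩ : (butterflyEdges w).Nonempty :=
      Finset.card_pos.1 (by rw [card_butterflyEdges hw]; norm_num)
    exact Finset.mem_biUnion.2
      ⟨e, butterflyEdges_subset hw he, Finset.mem_filter.2 ⟨hw, he⟩⟩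
  exact (Finset.card_le_card h).trans
    (Finset.card_biUnion_le_card_mul _ _ _ fun e he => butterfliesPerEdge_le he)

end Butterflies

/-! ### The probability that sampling at a fixed level fails, given a state of ADA -/

section Level

variable {α : Type*} [DecidableEq α]

/-- The expectation of `g` over a sample of all edges at rate `γ ^ K`, given that the edges seen so
far were sampled at rate `γ ^ k` and gave `S`, and that the edges of `U` are still to come. If level
`K` has been passed already, the value is `d`. -/
def levelExp (γ : ℝ) (K : ℕ) (g : Finset α → ℝ) (d : ℝ) (U : Finset α) (k : ℕ) (S : Finset α) : ℝ :=
  if k ≤ K then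
    bernoulliExp (γ ^ (K - k)) S (fun A => bernoulliExp (γ ^ K) U (fun C => g (A ∪ C)))
  else d

variable {γ : ℝ} (h0 : 0 ≤ γ) (h1 : γ ≤ 1)
include h0 h1

theorem levelExp_nonneg (K : ℕ) {g : Finset α → ℝ} (hg : ∀ A, 0 ≤ g A) {d : ℝ} (hd : 0 ≤ d)
    (U : Finset α) (k : ℕ) (S : Finset α) : 0 ≤ levelExp γ K g d U k S := by
  rw [levelExp]
  split_ifs
  · exact bernoulliExp_nonneg (pow_nonneg h0 _) (pow_le_one₀ h0 h1) fun A =>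
      bernoulliExp_nonneg (pow_nonneg h0 _) (pow_le_one₀ h0 h1) fun C => hg _
  · exact hd

/-- For `k < K`, this thinning is the first of the `K - k` thinnings already built into `levelExp`,
so equality holds. Only at `k = K` is something lost: the expectation of `g` is replaced by `d`. -/
theorem levelExp_resample_le (K : ℕ) {g : Finset α → ℝ} {d : ℝ} (U : Finset α) (k : ℕ)
    (S : Finset α) (hd : ∀ C, d ≤ g (S ∪ C)) :
    bernoulliExp γ S (fun A => levelExp γ K g d U (k + 1) A) ≤ levelExp γ K g d U k S := by
  rcases lt_trichotomy k K with hk | rfl | hk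
  · obtain ⟨j, rfl⟩ := Nat.exists_eq_add_of_lt hk
    have e1 : k + j + 1 - (k + 1) = j := by omega
    have e2 : k + j + 1 - k = j + 1 := by omega
    simp only [levelExp, if_pos (show k + 1 ≤ k + j + 1 by omega),
      if_pos (show k ≤ k + j + 1 by omega), e1, e2]
    rw [bernoulliExp_bernoulliExp, pow_succ' γ j]
  · simp only [levelExp, if_neg (show ¬k + 1 ≤ k by omega), le_refl, if_true, Nat.sub_self,
      pow_zero, bernoulliExp_one, bernoulliExp_const]
    conv_lhs => rw [← bernoulliExp_const (γ ^ k) U d]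
    exact bernoulliExp_mono (pow_nonneg h0 _) (pow_le_one₀ h0 h1) fun C _ => hd C
  · simp only [levelExp, if_neg (show ¬k + 1 ≤ K by omega), if_neg (show ¬k ≤ K by omega),
      bernoulliExp_const, le_refl]

-- A martingale step: condition on the coin of `e`. The edge enters with probability `γ ^ k` and
-- survives the later thinning with probability `γ ^ (K - k)`, in total the rate `γ ^ K` of a coming
-- edge.
omit h0 h1 in
theorem levelExp_insert (K : ℕ) (g : Finset α → ℝ) (d : ℝ) {U : Finset α} (k : ℕ)
    {S : Finset α} {e : α} (heU : e ∉ U) (heS : e ∉ S) :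
    γ ^ k * levelExp γ K g d U k (insert e S) + (1 - γ ^ k) * levelExp γ K g d U k S =
      levelExp γ K g d (insert e U) k S := by
  rw [levelExp, levelExp, levelExp]
  split_ifs with hk
  · have hpow : γ ^ K = γ ^ k * γ ^ (K - k) := by rw [← pow_add, Nat.add_sub_cancel' hk]
    simp only [bernoulliExp_insert _ heU, bernoulliExp_insert _ heS, bernoulliExp_add,
      bernoulliExp_const_mul, Finset.insert_union, Finset.union_insert]
    rw [hpow]
    ring
  · ring

end Level

/-! ### A supermartingale for ADA -/

section Potential

variable {L R : Type*} [DecidableEq L] [DecidableEq R]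

/-- The state of ADA with sampling probability `γ ^ k` and reservoir `S`. -/
def adaStateOf (γ : I) (k : ℕ) (S : Finset (L × R)) : AdaState L R :=
  ⟨γ ^ k, S, (((γ ^ k : I) : ℝ) ^ 4)⁻¹ * (numButterflies S : ℝ)⟩

theorem adaInit_eq (γ : I) : adaInit L R = adaStateOf γ 0 ∅ := by
  have h : numButterflies (∅ : Finset (L × R)) = 0 := by
    have := numButterflies_le (∅ : Finset (L × R))
    simpa using this
  simp [adaInit, adaStateOf, h]

theorem adaResample_adaStateOf (γ : I) (k : ℕ) (S : Finset (L × R)) :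
    adaResample γ (adaStateOf γ k S) = (subsample γ S).map (adaStateOf γ (k + 1)) := by
  simp only [adaResample, adaStateOf, ← pow_succ']
  rfl

/-- For a new edge, the incremental update of the estimate agrees with a full recount. Distinctness
of the stream is needed here. -/
theorem adaInsert_adaStateOf (γ : I) (k : ℕ) {S : Finset (L × R)} {e : L × R} (he : e ∉ S) :
    adaInsert (adaStateOf γ k S) e = adaStateOf γ k (insert e S) := by
  simp only [adaInsert, adaStateOf, numButterflies_insert he, Nat.cast_add, mul_add]

/-- The indicator function of the samples that are too large for the reservoir. -/
def overflow {α : Type*} (M : ℕ) (A : Finset α) : ℝ := if M ≤ A.card then 1 else 0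

theorem overflow_nonneg {α : Type*} (M : ℕ) (A : Finset α) : 0 ≤ overflow M A := by
  rw [overflow]; split_ifs <;> norm_num

/-- An upper bound on the probability that ADA fails. Failure means that ADA ends at a level
`K ≤ N` with a large value of `g K`, or that it leaves level `N`. -/
def failureBound {α : Type*} [DecidableEq α] (M N : ℕ) (γ : ℝ) (g : ℕ → Finset α → ℝ)
    (U : Finset α) (k : ℕ) (S : Finset α) : ℝ :=
  ∑ K ∈ Finset.range (N + 1), levelExp γ K (g K) 0 U k S + levelExp γ N (overflow M) 1 U k S

/-- `failureBound` as a function of the state of ADA; edges in the reservoir come from `V`, and the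
edges in `U` are still to come. -/
def adaPotential (M N : ℕ) (γ : I) (g : ℕ → Finset (L × R) → ℝ) (V U : Finset (L × R)) :
    Option (AdaState L R) → ℝ≥0∞
  | none => 1
  | some s => ⨅ (k : ℕ) (S : Finset (L × R)) (_ : S ⊆ V ∧ s = adaStateOf γ k S),
      ENNReal.ofReal (failureBound M N γ g U k S)

variable {M N : ℕ} {γ : I} {g : ℕ → Finset (L × R) → ℝ} {U V : Finset (L × R)}

theorem adaPotential_adaStateOf_le {k : ℕ} {S : Finset (L × R)} (hS : S ⊆ V) :
    adaPotential M N γ g V U (some (adaStateOf γ k S)) ≤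
      ENNReal.ofReal (failureBound M N γ g U k S) :=
  iInf_le_of_le k (iInf_le_of_le S (iInf_le _ ⟨hS, rfl⟩))

/-- All representations must be considered, as `γ ^ k` need not determine `k`. A state without a
representation has potential `∞`, so a finite expected potential also carries the invariant on the
form of the state. -/
theorem le_adaPotential {C : ℝ≥0∞} {s : AdaState L R}
    (h : ∀ k, ∀ S ⊆ V, s = adaStateOf γ k S → C ≤ ENNReal.ofReal (failureBound M N γ g U k S)) :
    C ≤ adaPotential M N γ g V U (some s) :=
  le_iInf fun k => le_iInf fun S => le_iInf fun hS => h k S hS.1 hS.2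

theorem failureBound_insert {k : ℕ} {S : Finset (L × R)} {e : L × R} (heU : e ∉ U) (heS : e ∉ S) :
    (γ : ℝ) ^ k * failureBound M N γ g U k (insert e S) +
        (1 - (γ : ℝ) ^ k) * failureBound M N γ g U k S =
      failureBound M N γ g (insert e U) k S := by
  simp only [failureBound, ← levelExp_insert _ _ _ k heU heS, Finset.sum_add_distrib,
    ← Finset.mul_sum]
  ring

variable (hg : ∀ K A, 0 ≤ g K A)
include hg

theorem failureBound_nonneg (k : ℕ) (S : Finset (L × R)) : 0 ≤ failureBound M N γ g U k S :=
  add_nonneg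
    (Finset.sum_nonneg fun K _ => levelExp_nonneg γ.2.1 γ.2.2 K (hg K) le_rfl U k S)
    (levelExp_nonneg γ.2.1 γ.2.2 N (overflow_nonneg M) zero_le_one U k S)

theorem one_le_failureBound {k : ℕ} (hk : N < k) (S : Finset (L × R)) :
    1 ≤ failureBound M N γ g U k S := by
  rw [failureBound, levelExp, if_neg (not_le.2 hk)]
  exact le_add_of_nonneg_left
    (Finset.sum_nonneg fun K _ => levelExp_nonneg γ.2.1 γ.2.2 K (hg K) le_rfl U k S)

/-- The loop condition justifies the value `1` after level `N` is left: every sample containing `S`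
overflows anyway. The deviation terms merely drop to `0`. -/
theorem failureBound_resample_le {k : ℕ} {S : Finset (L × R)} (hS : M ≤ S.card) :
    bernoulliExp γ S (failureBound M N γ g U (k + 1)) ≤ failureBound M N γ g U k S := by
  have e : failureBound M N γ g U (k + 1) = fun A =>
    ∑ K ∈ Finset.range (N + 1), levelExp γ K (g K) 0 U (k + 1) A +
      levelExp γ N (overflow M) 1 U (k + 1) A := rfl
  rw [e, bernoulliExp_add, bernoulliExp_sum, failureBound]
  refine add_le_add (Finset.sum_le_sum fun K _ => ?_) ?_
  · exact levelExp_resample_le γ.2.1 γ.2.2 K U k S fun C => hg K _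
  · refine levelExp_resample_le γ.2.1 γ.2.2 N U k S fun C => ?_
    rw [overflow, if_pos (hS.trans (Finset.card_le_card Finset.subset_union_left))]

/-- A loop cut off after `n` rounds has passed level `N`, where the bound is already at least `1`,
the potential of `none`. Thus non-termination needs no separate argument. -/
theorem adaPotential_whileFuel_le (n k : ℕ) {S : Finset (L × R)} (hS : S ⊆ V) (hn : N < n + k) :
    pmfExp (whileFuel (fun s' : AdaState L R => M ≤ s'.reservoir.card) (adaResample γ) n
      (adaStateOf γ k S)) (adaPotential M N γ g V U) ≤
        ENNReal.ofReal (failureBound M N γ g U k S) := by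
  induction n generalizing k S with
  | zero =>
    rw [whileFuel]
    split_ifs
    · rw [pmfExp_pure, adaPotential, ← ENNReal.ofReal_one]
      exact ENNReal.ofReal_le_ofReal (one_le_failureBound hg (by omega) S)
    · rw [pmfExp_pure]
      exact adaPotential_adaStateOf_le hS
  | succ n ih =>
    rw [whileFuel]
    split_ifs with hc
    · rw [pmfExp_bind, adaResample_adaStateOf, pmfExp_map]
      refine (pmfExp_subsample_le γ S (failureBound_nonneg (U := U) (M := M) hg (k + 1))
        fun A hA => ih (k + 1) (hA.trans hS) (by omega)).trans ?_
      exact ENNReal.ofReal_le_ofReal (failureBound_resample_le hg hc)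
    · rw [pmfExp_pure]
      exact adaPotential_adaStateOf_le hS

theorem adaPotential_adaStep_le {e : L × R} (heU : e ∉ U) (heV : e ∉ V) (s : AdaState L R) :
    pmfExp (adaStep M γ e s) (adaPotential M N γ g (insert e V) U) ≤
      adaPotential M N γ g V (insert e U) (some s) := by
  refine le_adaPotential fun k S hS hs => ?_
  subst hs
  rw [adaStep, pmfExp_bind]
  refine (pmfExp_mono _ (g := adaPotential M N γ g V (insert e U)) ?_).trans
    (pmfExp_whileLoop_le _ _ _ _ (N := N + 1) fun n hn =>
      adaPotential_whileFuel_le hg n k hS (by omega))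
  rintro (_ | s)
  · simp only [pmfExp_pure, adaPotential, le_refl]
  · refine le_adaPotential fun k S hS hs => ?_
    subst hs
    have heS : e ∉ S := fun h => heV (hS h)
    have hp : (((adaStateOf γ k S).p : I) : ℝ) = (γ : ℝ) ^ k := by
      simp [adaStateOf]
    have h0 : 0 ≤ (γ : ℝ) ^ k := pow_nonneg γ.2.1 _
    have h1 : 0 ≤ 1 - (γ : ℝ) ^ k := sub_nonneg.2 (pow_le_one₀ γ.2.1 γ.2.2)
    simp only [pmfExp_map, pmfExp_coinFlip, if_true, hp, adaInsert_adaStateOf γ k heS,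
      Bool.false_eq_true, if_false]
    rw [← failureBound_insert heU heS,
      ENNReal.ofReal_add (mul_nonneg h0 (failureBound_nonneg hg _ _))
        (mul_nonneg h1 (failureBound_nonneg hg _ _)), ENNReal.ofReal_mul h0, ENNReal.ofReal_mul h1]
    gcongr
    · exact adaPotential_adaStateOf_le (Finset.insert_subset_insert e hS)
    · exact adaPotential_adaStateOf_le (hS.trans (Finset.subset_insert e V))

theorem adaPotential_adaRun_le (e : ℕ → L × R) (t i : ℕ) (he : Set.InjOn e (Set.Iio t))
    (hi : i ≤ t) :
    pmfExp (adaRun M γ e i)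
        (adaPotential M N γ g (streamGraph e i) ((Finset.Ico i t).image e)) ≤
      ENNReal.ofReal (failureBound M N γ g (streamGraph e t) 0 ∅) := by
  induction i with
  | zero =>
    rw [adaRun, pmfExp_pure, adaInit_eq γ, ← Finset.range_eq_Ico]
    change adaPotential M N γ g _ (streamGraph e t) _ ≤ _
    exact adaPotential_adaStateOf_le (Finset.empty_subset _)
  | succ i ih =>
    refine le_trans ?_ (ih (by omega))
    rw [adaRun, pmfExp_bind]
    refine pmfExp_mono _ ?_
    have hinj : ∀ j < t, e j = e i → j = i := fun j hj h =>
      he (Set.mem_Iio.2 hj) (Set.mem_Iio.2 (by omega)) h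
    have hV : e i ∉ streamGraph e i := by
      simp only [streamGraph, Finset.mem_image, Finset.mem_range, not_exists, not_and]
      intro j hj h
      have := hinj j (by omega) h
      omega
    have hU : e i ∉ (Finset.Ico (i + 1) t).image e := by
      simp only [Finset.mem_image, Finset.mem_Ico, not_exists, not_and]
      intro j hj h
      have := hinj j (by omega) h
      omega
    have eV : streamGraph e (i + 1) = insert (e i) (streamGraph e i) := by
      rw [streamGraph, Finset.range_add_one, Finset.image_insert, streamGraph]
    have eU : (Finset.Ico i t).image e = insert (e i) ((Finset.Ico (i + 1) t).image e) := by
      rw [← Finset.image_insert, Finset.insert_Ico_add_one_left_eq_Ico (by omega)]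
    rintro (_ | s)
    · simp only [pmfExp_pure, adaPotential, le_refl]
    · rw [eV, eU]
      exact adaPotential_adaStep_le hg hU hV s

-- The initial end of the supermartingale, a plain Bernoulli sample of all edges; `levelExp_self` is
-- the final end.
omit hg in
theorem levelExp_zero_empty {α : Type*} [DecidableEq α] (γ : ℝ) (K : ℕ) (g : Finset α → ℝ) (d : ℝ)
    (U : Finset α) : levelExp γ K g d U 0 ∅ = bernoulliExp (γ ^ K) U g := by
  simp [levelExp, bernoulliExp_empty]

omit hg in
theorem levelExp_self {α : Type*} [DecidableEq α] (γ : ℝ) (k : ℕ) (g : Finset α → ℝ) (d : ℝ)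
    (S : Finset α) : levelExp γ k g d ∅ k S = g S := by
  simp [levelExp, bernoulliExp_empty, bernoulliExp_one]

/-- The indicator function of the samples at rate `q` whose estimate is off by at least `D`. -/
def deviates (E : Finset (L × R)) (D q : ℝ) (A : Finset (L × R)) : ℝ :=
  if D ≤ |(q ^ 4)⁻¹ * (numButterflies A : ℝ) - (numButterflies E : ℝ)| then 1 else 0

omit hg in
theorem deviates_nonneg (E : Finset (L × R)) (D q : ℝ) (A : Finset (L × R)) :
    0 ≤ deviates E D q A := by
  rw [deviates]; split_ifs <;> norm_num

omit hg in
/-- ADA fails with at most the probability that plain sampling fails at one of the levels up to `N`,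
or that sampling at level `N` fills the reservoir. -/
theorem adaEstimate_deviation_le (e : ℕ → L × R) (t : ℕ) (he : Set.InjOn e (Set.Iio t))
    (M N : ℕ) (γ : I) (D : ℝ) :
    (adaEstimate M γ e t).toOuterMeasure
        {o : Option ℝ | ∀ Y ∈ o, D ≤ |Y - (numButterflies (streamGraph e t) : ℝ)|} ≤
      ENNReal.ofReal (∑ K ∈ Finset.range (N + 1), bernoulliExp ((γ : ℝ) ^ K) (streamGraph e t)
          (deviates (streamGraph e t) D ((γ : ℝ) ^ K)) +
        bernoulliExp ((γ : ℝ) ^ N) (streamGraph e t) (overflow M)) := by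
  set g : ℕ → Finset (L × R) → ℝ := fun K => deviates (streamGraph e t) D ((γ : ℝ) ^ K) with hgdef
  have hg : ∀ K A, 0 ≤ g K A := fun K A => deviates_nonneg _ _ _ _
  have key := adaPotential_adaRun_le (M := M) (N := N) (γ := γ) hg e t t he le_rfl
  simp only [failureBound, levelExp_zero_empty, Finset.Ico_self, Finset.image_empty] at key
  refine le_trans ?_ key
  rw [adaEstimate, PMF.toOuterMeasure_map_apply]
  refine toOuterMeasure_le_pmfExp _ _ ?_
  rintro (_ | s) hs
  · exact le_rfl
  · refine le_adaPotential fun k S hS hk => ?_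
    rw [← ENNReal.ofReal_one]
    refine ENNReal.ofReal_le_ofReal ?_
    rcases lt_or_ge N k with hNk | hkN
    · exact one_le_failureBound hg hNk S
    · have hβ := hs s.β rfl
      have h1 : g k S = 1 := by
        rw [hgdef]
        refine if_pos ?_
        simpa [hk, adaStateOf] using! hβ
      refine le_add_of_le_of_nonneg ?_
        (levelExp_nonneg γ.2.1 γ.2.2 N (overflow_nonneg M) zero_le_one _ _ _)
      -- Of the sum, only the term of the actual final level `k` is needed.
      rw [← h1, ← levelExp_self (γ : ℝ) k (g k) 0 S]
      exact Finset.single_le_sum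
        (f := fun K => levelExp (γ : ℝ) K (g K) 0 (∅ : Finset (L × R)) k S)
        (fun K _ => levelExp_nonneg γ.2.1 γ.2.2 K (hg K) le_rfl _ _ _)
        (Finset.mem_range.2 (by omega))

end Potential

/-! ### Concentration of the number of butterflies in a random sample -/

section Concentration

variable {α ι : Type*} [DecidableEq α]

/-- Disjoint sets are contained in `A` independently. Expanding the product of `1 + (exp y - 1) 1[W
j ⊆ A]` over subfamilies `T` reduces this to the union of `T` having `m * |T|` elements. -/
theorem bernoulliExp_exp_card_le {q : ℝ} (h0 : 0 ≤ q) (h1 : q ≤ 1) {S : Finset α}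
    (J : Finset ι) (W : ι → Finset α) {m : ℕ} (hW : ∀ j ∈ J, W j ⊆ S)
    (hcard : ∀ j ∈ J, (W j).card = m) (hdisj : (J : Set ι).PairwiseDisjoint W) (y : ℝ) :
    bernoulliExp q S (fun A => Real.exp (y * ((J.filter (fun j => W j ⊆ A)).card : ℝ))) ≤
      Real.exp (J.card * (q ^ m * (Real.exp y - 1))) := by
  classical
  have hexp : ∀ A, Real.exp (y * ((J.filter (fun j => W j ⊆ A)).card : ℝ)) =
      ∑ T ∈ J.powerset, (Real.exp y - 1) ^ T.card * if T.biUnion W ⊆ A then 1 else 0 := by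
    intro A
    calc Real.exp (y * ((J.filter (fun j => W j ⊆ A)).card : ℝ))
        = ∏ j ∈ J, (1 + if W j ⊆ A then Real.exp y - 1 else 0) := by
          rw [mul_comm, Real.exp_nat_mul, ← Finset.prod_const, Finset.prod_filter]
          refine Finset.prod_congr rfl fun j _ => ?_
          split_ifs <;> ring
      _ = _ := by
          rw [Finset.prod_one_add]
          refine Finset.sum_congr rfl fun T _ => ?_
          rw [← Finset.prod_const, Finset.prod_ite_zero]
          simp only [Finset.biUnion_subset, mul_ite, mul_one, mul_zero]
  have hmean : ∀ T ∈ J.powerset, bernoulliExp q S (fun A => (Real.exp y - 1) ^ T.card *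
      if T.biUnion W ⊆ A then (1 : ℝ) else 0) = (q ^ m * (Real.exp y - 1)) ^ T.card := by
    intro T hT
    rw [Finset.mem_powerset] at hT
    rw [bernoulliExp_const_mul,
      bernoulliExp_subset_indicator q (Finset.biUnion_subset.2 fun j hj => hW j (hT hj)),
      Finset.card_biUnion fun i hi j hj hij => hdisj (hT hi) (hT hj) hij,
      Finset.sum_congr rfl fun j hj => hcard j (hT hj), Finset.sum_const, smul_eq_mul, mul_comm _ m,
      pow_mul, mul_pow, mul_comm]
  simp only [hexp]
  rw [bernoulliExp_sum, Finset.sum_congr rfl hmean]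
  have hsum : ∑ T ∈ J.powerset, (q ^ m * (Real.exp y - 1)) ^ T.card =
      (1 + q ^ m * (Real.exp y - 1)) ^ J.card := by
    rw [← Finset.prod_const, Finset.prod_one_add]
    exact Finset.sum_congr rfl fun T _ => (Finset.prod_const _).symm
  rw [hsum, Real.exp_nat_mul]
  -- The base equals `(1 - q ^ m) + q ^ m * exp y`, nonnegative also when `y < 0`.
  refine pow_le_pow_left₀ ?_ ?_ _
  · have := pow_nonneg h0 m
    have := pow_le_one₀ (n := m) h0 h1
    have := Real.exp_pos y
    nlinarith
  · rw [add_comm]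
    exact Real.add_one_le_exp _

/-- If a family of sets of size `m` splits into `n` subfamilies of disjoint sets, the number of its
members contained in a random set has the exponential moments of a sum of independent variables,
up to a factor `n` in the exponent. -/
theorem bernoulliExp_exp_card_le_of_coloring {q : ℝ} (h0 : 0 ≤ q) (h1 : q ≤ 1) {S : Finset α}
    (J : Finset ι) (W : ι → Finset α) {m n : ℕ} (hn : 0 < n) (hW : ∀ j ∈ J, W j ⊆ S)
    (hcard : ∀ j ∈ J, (W j).card = m) (col : ι → Fin n)
    (hcol : ∀ i ∈ J, ∀ j ∈ J, i ≠ j → ¬Disjoint (W i) (W j) → col i ≠ col j) (y : ℝ) :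
    bernoulliExp q S (fun A => Real.exp (y / n * ((J.filter (fun j => W j ⊆ A)).card : ℝ))) ≤
      Real.exp (J.card * (q ^ m * (Real.exp y - 1)) / n) := by
  have hn' : (0 : ℝ) < n := Nat.cast_pos.2 hn
  set μ := q ^ m * (Real.exp y - 1) with hμ
  set Jc : Fin n → Finset ι := fun c => J.filter (fun j => col j = c) with hJc
  have hJcJ : ∀ c, ∀ j ∈ Jc c, j ∈ J := fun c j hj => (Finset.mem_filter.1 hj).1
  have hclass : ∀ c, bernoulliExp q S (fun A => Real.exp
      (y * (((Jc c).filter (fun j => W j ⊆ A)).card : ℝ) - (Jc c).card * μ)) ≤ 1 := by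
    intro c
    have h := bernoulliExp_exp_card_le h0 h1 (Jc c) W (fun j hj => hW j (hJcJ c j hj))
      (fun j hj => hcard j (hJcJ c j hj)) (fun i hi j hj hij => by
        by_contra hd
        refine hcol i (hJcJ c i hi) j (hJcJ c j hj) hij hd ?_
        rw [(Finset.mem_filter.1 hi).2, (Finset.mem_filter.1 hj).2]) y
    simp only [Real.exp_sub, div_eq_inv_mul]
    rw [bernoulliExp_const_mul]
    exact (mul_le_mul_of_nonneg_left h (by positivity)).trans_eq
      (inv_mul_cancel₀ (Real.exp_pos _).ne')
  have hcount : ∀ A, ((J.filter (fun j => W j ⊆ A)).card : ℝ) =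
      ∑ c, (((Jc c).filter (fun j => W j ⊆ A)).card : ℝ) := by
    intro A
    rw [Finset.card_eq_sum_card_fiberwise (f := col) (t := Finset.univ)
      (fun _ _ => Finset.mem_coe.2 (Finset.mem_univ _))]
    push_cast
    refine Finset.sum_congr rfl fun c _ => ?_
    rw [hJc, Finset.filter_filter, Finset.filter_filter]
    simp only [and_comm]
  have htotal : (J.card : ℝ) = ∑ c, ((Jc c).card : ℝ) := by
    rw [Finset.card_eq_sum_card_fiberwise (f := col) (t := Finset.univ)
      (fun _ _ => Finset.mem_coe.2 (Finset.mem_univ _))]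
    push_cast
    rfl
  -- Jensen for the average over the colours. Centring each class by its own `card * μ` beforehand
  -- bounds every averaged expectation by `1`, so classes of unequal size cost nothing.
  have hpt : ∀ A, Real.exp (y / n * ((J.filter (fun j => W j ⊆ A)).card : ℝ)) ≤
      Real.exp (J.card * μ / n) * ∑ c, (n : ℝ)⁻¹ * Real.exp
        (y * (((Jc c).filter (fun j => W j ⊆ A)).card : ℝ) - (Jc c).card * μ) := by
    intro A
    have hconv := convexOn_exp.map_sum_le (t := Finset.univ) (w := fun _ : Fin n => (n : ℝ)⁻¹)
      (p := fun c => y * (((Jc c).filter (fun j => W j ⊆ A)).card : ℝ) - (Jc c).card * μ)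
      (fun _ _ => by positivity)
      (by simp [hn'.ne']) (fun _ _ => Set.mem_univ _)
    simp only [smul_eq_mul] at hconv
    refine le_trans (le_of_eq ?_) (mul_le_mul_of_nonneg_left hconv (Real.exp_pos _).le)
    rw [← Real.exp_add, ← Finset.mul_sum, Finset.sum_sub_distrib, ← Finset.mul_sum,
      ← Finset.sum_mul, ← hcount, ← htotal]
    congr 1
    field_simp
    ring
  refine (bernoulliExp_mono h0 h1 fun A _ => hpt A).trans ?_
  rw [bernoulliExp_const_mul, bernoulliExp_sum]
  refine mul_le_of_le_one_right (Real.exp_pos _).le ?_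
  simp only [bernoulliExp_const_mul]
  calc ∑ c, (n : ℝ)⁻¹ * _ ≤ ∑ _c : Fin n, (n : ℝ)⁻¹ * 1 :=
        Finset.sum_le_sum fun c _ => mul_le_mul_of_nonneg_left (hclass c) (by positivity)
    _ = 1 := by simp [hn'.ne']

/-- Greedy colouring: a symmetric relation where every element has fewer than `n` neighbours has a
proper colouring with `n` colours. -/
theorem exists_greedy_coloring [DecidableEq ι] (r : ι → ι → Prop) (hr : ∀ i j, r i j → r j i)
    [DecidableRel r] {n : ℕ} (hn : 0 < n) (J : Finset ι)
    (hdeg : ∀ j ∈ J, (J.filter (fun i => i ≠ j ∧ r i j)).card < n) :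
    ∃ col : ι → Fin n, ∀ i ∈ J, ∀ j ∈ J, i ≠ j → r i j → col i ≠ col j := by
  induction J using Finset.induction_on with
  | empty => exact ⟨fun _ => ⟨0, hn⟩, by simp⟩
  | insert a J ha ih =>
    obtain ⟨col, hcol⟩ := ih fun j hj => lt_of_le_of_lt
      (Finset.card_le_card (Finset.filter_subset_filter _ (Finset.subset_insert a J)))
      (hdeg j (Finset.mem_insert_of_mem hj))
    obtain ⟨c, hc⟩ : ∃ c : Fin n, c ∉ (J.filter (fun i => i ≠ a ∧ r i a)).image col := by
      by_contra! hall
      have hlt : ((J.filter (fun i => i ≠ a ∧ r i a)).image col).card < n :=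
        lt_of_le_of_lt (Finset.card_image_le.trans
          (Finset.card_le_card (Finset.filter_subset_filter _ (Finset.subset_insert a J))))
          (hdeg a (Finset.mem_insert_self a J))
      rw [Finset.eq_univ_iff_forall.2 hall, Finset.card_univ, Fintype.card_fin] at hlt
      exact lt_irrefl _ hlt
    have hne : ∀ i ∈ J, r i a → col i ≠ c := fun i hi hia heq =>
      hc (Finset.mem_image.2 ⟨i, Finset.mem_filter.2
        ⟨hi, fun h : i = a => ha (h ▸ hi), hia⟩, heq⟩)
    have hupd : ∀ i ∈ J, Function.update col a c i = col i := fun i hi =>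
      Function.update_of_ne (fun h : i = a => ha (h ▸ hi)) _ _
    refine ⟨Function.update col a c, fun i hi j hj hij hrij => ?_⟩
    rcases Finset.mem_insert.1 hi with rfl | hi' <;> rcases Finset.mem_insert.1 hj with rfl | hj'
    · exact absurd rfl hij
    · rw [Function.update_self, hupd j hj']
      exact (hne j hj' (hr _ _ hrij)).symm
    · rw [Function.update_self, hupd i hi']
      exact hne i hi' hrij
    · rw [hupd i hi', hupd j hj']
      exact hcol i hi' j hj' hij hrij

theorem exp_le_one_add_add_sq {x : ℝ} (hx : |x| ≤ 1) : Real.exp x ≤ 1 + x + 3 / 4 * x ^ 2 := by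
  have h := (abs_le.1 (Real.exp_bound hx (n := 2) (by norm_num))).2
  simp only [Finset.sum_range_succ, Finset.sum_range_zero, sq_abs] at h
  norm_num [Nat.factorial] at h
  linarith

end Concentration

/-! ### Chernoff bounds for butterflies -/

section ButterflyConcentration

variable {L R : Type*} [DecidableEq L] [DecidableEq R]

/-- Each of the four edges of `w` lies in at most `maxButterfliesPerEdge E` butterflies. The
inequality is strict because `w` meets itself but is excluded from the count; hence this many
colours suffice. -/
theorem card_adjacent_butterflies_lt {E : Finset (L × R)} {w : Finset L × Finset R}
    (hw : w ∈ butterflies E) :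
    ((butterflies E).filter (fun v => v ≠ w ∧
      ¬Disjoint (butterflyEdges v) (butterflyEdges w))).card < 4 * maxButterfliesPerEdge E := by
  have h1 : (butterflies E).filter (fun v => ¬Disjoint (butterflyEdges v) (butterflyEdges w)) ⊆
      (butterflyEdges w).biUnion
        (fun e => (butterflies E).filter (fun v => e ∈ v.1 ×ˢ v.2)) := by
    intro v hv
    obtain ⟨hvE, hvw⟩ := Finset.mem_filter.1 hv
    obtain ⟨e, hev, hew⟩ := Finset.not_disjoint_iff.1 hvw
    exact Finset.mem_biUnion.2 ⟨e, hew, Finset.mem_filter.2 ⟨hvE, hev⟩⟩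
  have h2 : (butterflies E).filter (fun v => v ≠ w ∧
      ¬Disjoint (butterflyEdges v) (butterflyEdges w)) ⊂
      (butterflies E).filter (fun v => ¬Disjoint (butterflyEdges v) (butterflyEdges w)) := by
    refine (Finset.ssubset_iff_of_subset
      (Finset.monotone_filter_right _ fun v _ hv => hv.2)).2 ⟨w, ?_, by simp⟩
    refine Finset.mem_filter.2 ⟨hw, fun h => ?_⟩
    have := card_butterflyEdges hw
    rw [disjoint_self.1 h] at this
    simp at this
  refine (Finset.card_lt_card h2).trans_le ((Finset.card_le_card h1).trans ?_)
  rw [← card_butterflyEdges hw]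
  exact Finset.card_biUnion_le_card_mul _ _ _ fun e he =>
    butterfliesPerEdge_le (butterflyEdges_subset hw he)

theorem bernoulliExp_exp_numButterflies_le {E : Finset (L × R)}
    (hh : 0 < maxButterfliesPerEdge E) {q : ℝ} (h0 : 0 ≤ q) (h1 : q ≤ 1) (y : ℝ) :
    bernoulliExp q E (fun A => Real.exp
        (y / (4 * maxButterfliesPerEdge E) * (numButterflies A : ℝ))) ≤
      Real.exp (numButterflies E * (q ^ 4 * (Real.exp y - 1)) / (4 * maxButterfliesPerEdge E)) := by
  obtain ⟨col, hcol⟩ := exists_greedy_coloring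
    (fun v w : Finset L × Finset R => ¬Disjoint (butterflyEdges v) (butterflyEdges w))
    (fun v w h h' => h h'.symm) (n := 4 * maxButterfliesPerEdge E) (by omega) (butterflies E)
    fun w hw => card_adjacent_butterflies_lt hw
  have h := bernoulliExp_exp_card_le_of_coloring h0 h1 (butterflies E) butterflyEdges
    (by omega) (fun w hw => butterflyEdges_subset hw) (fun w hw => card_butterflyEdges hw) col hcol y
  push_cast at h
  refine le_of_eq_of_le (bernoulliExp_congr fun A hA => ?_) h
  rw [numButterflies, butterflies_of_subset hA]

theorem bernoulliExp_deviates_le {E : Finset (L × R)} (hh : 0 < maxButterfliesPerEdge E)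
    {q : ℝ} (h0 : 0 < q) (h1 : q ≤ 1) {ε : ℝ} (hε : 0 ≤ ε) (hε1 : ε ≤ 1) :
    bernoulliExp q E (deviates E (ε * numButterflies E) q) ≤
      2 * Real.exp (-(ε ^ 2 * numButterflies E * q ^ 4 / (12 * maxButterfliesPerEdge E))) := by
  set h : ℝ := (maxButterfliesPerEdge E : ℝ) with hdef
  set B : ℝ := (numButterflies E : ℝ) with hB
  have hpos : 0 < h := Nat.cast_pos.2 hh
  have hBnn : 0 ≤ B := Nat.cast_nonneg _
  have hq4 : 0 < q ^ 4 := by positivity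
  -- Minimises `3/4 * y ^ 2 - ε * y`, the bound that `exp_le_one_add_add_sq` leaves in both tails;
  -- the minimum is `-ε ^ 2 / 3`.
  set y : ℝ := 2 * ε / 3 with hy
  have hy0 : 0 ≤ y := by positivity
  have hpt : ∀ A, deviates E (ε * B) q A ≤
      Real.exp (-(y / (4 * h) * ((1 + ε) * B * q ^ 4))) *
        Real.exp (y / (4 * h) * (numButterflies A : ℝ)) +
      Real.exp (y / (4 * h) * ((1 - ε) * B * q ^ 4)) *
        Real.exp (-y / (4 * h) * (numButterflies A : ℝ)) := by
    intro A
    rw [← Real.exp_add, ← Real.exp_add, deviates]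
    split_ifs with hd
    · rcases le_abs'.1 hd with hd | hd
      · refine le_add_of_nonneg_of_le (Real.exp_pos _).le (Real.one_le_exp ?_)
        have : (numButterflies A : ℝ) ≤ (1 - ε) * B * q ^ 4 := by
          rw [← div_le_iff₀ hq4, div_eq_inv_mul]
          linarith
        have e : y / (4 * h) * ((1 - ε) * B * q ^ 4) + -y / (4 * h) * (numButterflies A : ℝ) =
          y / (4 * h) * ((1 - ε) * B * q ^ 4 - numButterflies A) := by ring
        rw [e]
        exact mul_nonneg (by positivity) (sub_nonneg.2 this)
      · refine le_add_of_le_of_nonneg (Real.one_le_exp ?_) (Real.exp_pos _).le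
        have : (1 + ε) * B * q ^ 4 ≤ (numButterflies A : ℝ) := by
          rw [← le_div_iff₀ hq4, div_eq_inv_mul]
          linarith
        have e : -(y / (4 * h) * ((1 + ε) * B * q ^ 4)) + y / (4 * h) * (numButterflies A : ℝ) =
          y / (4 * h) * (numButterflies A - (1 + ε) * B * q ^ 4) := by ring
        rw [e]
        exact mul_nonneg (by positivity) (sub_nonneg.2 this)
    · positivity
  have key : ∀ z c : ℝ, Real.exp z - 1 + c ≤ -(ε ^ 2 / 3) →
      Real.exp (c * (B * q ^ 4 / (4 * h))) *
        bernoulliExp q E (fun A => Real.exp (z / (4 * h) * (numButterflies A : ℝ))) ≤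
      Real.exp (-(ε ^ 2 * B * q ^ 4 / (12 * h))) := by
    intro z c hz
    refine (mul_le_mul_of_nonneg_left (bernoulliExp_exp_numButterflies_le hh h0.le h1 z)
      (Real.exp_pos _).le).trans ?_
    rw [← Real.exp_add]
    refine Real.exp_le_exp.2 ?_
    have := mul_le_mul_of_nonneg_right hz (show 0 ≤ B * q ^ 4 / (4 * h) by positivity)
    calc _ = (Real.exp z - 1 + c) * (B * q ^ 4 / (4 * h)) := by ring
      _ ≤ _ := this
      _ = _ := by ring
  refine (bernoulliExp_mono h0.le h1 fun A _ => hpt A).trans ?_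
  rw [bernoulliExp_add, bernoulliExp_const_mul, bernoulliExp_const_mul, two_mul]
  refine add_le_add ?_ ?_
  · have hx := exp_le_one_add_add_sq (x := y) (by rw [abs_of_nonneg hy0, hy]; linarith)
    have := key y (-(y * (1 + ε))) (by rw [hy] at hx ⊢; nlinarith)
    refine (le_of_eq ?_).trans this
    congr 2
    ring
  · have hx := exp_le_one_add_add_sq (x := -y) (by rw [abs_neg, abs_of_nonneg hy0, hy]; linarith)
    have := key (-y) (y * (1 - ε)) (by rw [hy] at hx ⊢; nlinarith)
    refine (le_of_eq ?_).trans this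
    congr 2
    ring

end ButterflyConcentration

/-! ### Overflow of the reservoir and the choice of the last level -/

/-- Markov's inequality for `2 ^ A.card`, whose mean is `(1 + q) ^ S.card`. -/
theorem bernoulliExp_overflow_le {α : Type*} {q : ℝ} (h0 : 0 ≤ q) (h1 : q ≤ 1) (M : ℕ)
    (S : Finset α) :
    bernoulliExp q S (overflow M) ≤ Real.exp (S.card * q - M * Real.log 2) := by
  have hpt : ∀ A : Finset α, overflow M A ≤ ((2 : ℝ) ^ M)⁻¹ * (2 : ℝ) ^ A.card := by
    intro A
    rw [overflow]
    split_ifs with h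
    · rw [← div_eq_inv_mul, one_le_div (by positivity)]
      exact pow_le_pow_right₀ one_le_two h
    · positivity
  refine (bernoulliExp_mono h0 h1 fun A _ => hpt A).trans ?_
  rw [bernoulliExp_const_mul, bernoulliExp_pow_card, Real.exp_sub, Real.exp_nat_mul,
    Real.exp_nat_mul, Real.exp_log two_pos, div_eq_inv_mul]
  gcongr
  have := Real.add_one_le_exp q
  linarith

/-- If the failure probability at the last level is `exp (-l)` and the exponents grow
geometrically towards the earlier levels, the sum over all levels is `O(exp (-l))`. -/
theorem sum_exp_levels_le {l : ℝ} (hl : Real.exp (-l) ≤ 1 / 4) (N : ℕ) (f : ℕ → ℝ)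
    (hf : ∀ j ≤ N, f (N - j) ≤ 2 * Real.exp (-(l * (1 + j * (1 / 2))))) :
    ∑ K ∈ Finset.range (N + 1), f K ≤ 4 * Real.exp (-l) := by
  set r := Real.exp (-(l / 2)) with hr
  have hr0 : 0 < r := Real.exp_pos _
  have hr2 : r ^ 2 = Real.exp (-l) := by
    rw [hr, ← Real.exp_nat_mul]
    congr 1
    push_cast
    ring
  have hr1 : r ≤ 1 / 2 := by nlinarith
  rw [← Finset.sum_range_reflect]
  calc ∑ j ∈ Finset.range (N + 1), f (N + 1 - 1 - j)
      ≤ ∑ j ∈ Finset.range (N + 1), 2 * Real.exp (-l) * r ^ j := by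
        refine Finset.sum_le_sum fun j hj => ?_
        refine (hf j (by have := Finset.mem_range.1 hj; omega)).trans_eq ?_
        rw [hr, ← Real.exp_nat_mul, mul_assoc, ← Real.exp_add]
        congr 2
        ring
    _ = 2 * Real.exp (-l) * ∑ j ∈ Finset.range (N + 1), r ^ j := by rw [Finset.mul_sum]
    _ ≤ 2 * Real.exp (-l) * 2 := by
        refine mul_le_mul_of_nonneg_left ?_ (by positivity)
        rw [geom_sum_eq (by linarith), div_le_iff_of_neg (by linarith)]
        have := pow_pos hr0 (N + 1)
        linarith
    _ = _ := by ring

/-- Since `0.9 ^ 4 < 2 / 3`, going back `j` levels multiplies the Chernoff exponent by at least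
`(3/2) ^ j`; Bernoulli's inequality weakens this to the linear growth that `sum_exp_levels_le` uses.
-/
theorem one_add_mul_half_mul_pow_le {γ : ℝ} (h0 : 0 ≤ γ) (h9 : γ ≤ 0.9) (j : ℕ) :
    (γ ^ j) ^ 4 * (1 + j * (1 / 2)) ≤ 1 := by
  have h4 : γ ^ 4 ≤ 2 / 3 := (pow_le_pow_left₀ h0 h9 4).trans (by norm_num)
  have hb : 1 + (j : ℝ) * (1 / 2) ≤ (1 + 1 / 2 : ℝ) ^ j := one_add_mul_le_pow (by norm_num) j
  calc (γ ^ j) ^ 4 * (1 + j * (1 / 2)) ≤ (2 / 3) ^ j * (1 + 1 / 2 : ℝ) ^ j := by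
        rw [← pow_mul, mul_comm j, pow_mul]
        gcongr
    _ = 1 := by rw [← mul_pow]; norm_num

/-- `P` is the critical rate, at which the Chernoff exponent is exactly `l`. -/
theorem sampling_failure_le {L R : Type*} [DecidableEq L] [DecidableEq R] {E : Finset (L × R)}
    {t M : ℕ} (hEt : E.card ≤ t) (hB : 0 < numButterflies E) {γ ε l P : ℝ} (hγ : 1 / 2 ≤ γ)
    (hγ' : γ ≤ 0.9) (hε : 0 < ε) (hε1 : ε ≤ 1) (hl : Real.exp (-l) ≤ 1 / 4) (hP : 0 < P)
    (hP4 : P ^ 4 = 12 * maxButterfliesPerEdge E / (ε ^ 2 * numButterflies E) * l)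
    (hM : 6 * t * P ≤ M) :
    ∃ N : ℕ, ∑ K ∈ Finset.range (N + 1), bernoulliExp (γ ^ K) E
        (deviates E (ε * numButterflies E) (γ ^ K)) + bernoulliExp (γ ^ N) E (overflow M) ≤
      5 * Real.exp (-l) := by
  have hBle : numButterflies E ≤ t * maxButterfliesPerEdge E :=
    (numButterflies_le E).trans (Nat.mul_le_mul_right _ hEt)
  have hhpos : 0 < maxButterfliesPerEdge E := Nat.pos_of_mul_pos_left (hB.trans_le hBle)
  have htpos : 0 < t := Nat.pos_of_mul_pos_right (hB.trans_le hBle)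
  have hBle' : (numButterflies E : ℝ) ≤ t * maxButterfliesPerEdge E := by exact_mod_cast hBle
  have ht : (0 : ℝ) < t := Nat.cast_pos.2 htpos
  have hBr : (0 : ℝ) < numButterflies E := Nat.cast_pos.2 hB
  have hhr : (0 : ℝ) < maxButterfliesPerEdge E := Nat.cast_pos.2 hhpos
  have hγ0 : 0 < γ := by linarith
  have hγ1 : γ < 1 := by norm_num at hγ'; linarith
  rcases le_or_gt 1 P with hP1 | hP1
  -- Here `M > t`: level `0` keeps all edges, is exact and cannot overflow.
  · refine ⟨0, ?_⟩
    have hMt : E.card < M := by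
      have : (t : ℝ) < M := by nlinarith
      exact hEt.trans_lt (by exact_mod_cast this)
    have hd : ¬ε * (numButterflies E : ℝ) ≤ 0 := not_le.2 (by positivity)
    simp only [zero_add, Finset.sum_range_one, pow_zero, bernoulliExp_one, deviates, overflow,
      one_pow, inv_one, one_mul, sub_self, abs_zero, if_neg hd, if_neg (not_le.2 hMt)]
    positivity
  · have hl0 : 0 < l := by
      by_contra! h
      have := Real.one_le_exp (neg_nonneg.2 h)
      linarith
    -- `N` is the last level of rate at least `P`. The next rate is below `P`, so `γ ≥ 1/2` gives `γ
    -- ^ N ≤ 2 * P`.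
    obtain ⟨N, hN1, hN2⟩ := exists_nat_pow_near_of_lt_one hP hP1.le hγ0 hγ1
    refine ⟨N, ?_⟩
    have hsum := sum_exp_levels_le hl N (fun K => bernoulliExp (γ ^ K) E
        (deviates E (ε * numButterflies E) (γ ^ K))) (fun j hj => by
      refine (bernoulliExp_deviates_le hhpos (pow_pos hγ0 _) (pow_le_one₀ hγ0.le hγ1.le)
        hε.le hε1).trans ?_
      refine mul_le_mul_of_nonneg_left (Real.exp_le_exp.2 (neg_le_neg ?_)) two_pos.le
      have hq : P ^ 4 * (1 + j * (1 / 2)) ≤ (γ ^ (N - j)) ^ 4 := by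
        calc P ^ 4 * (1 + j * (1 / 2)) ≤ (γ ^ N) ^ 4 * (1 + j * (1 / 2)) := by gcongr
          _ = (γ ^ (N - j)) ^ 4 * ((γ ^ j) ^ 4 * (1 + j * (1 / 2))) := by
              rw [← Nat.sub_add_cancel hj, pow_add, Nat.add_sub_cancel]
              ring
          _ ≤ (γ ^ (N - j)) ^ 4 * 1 := by
              gcongr
              exact one_add_mul_half_mul_pow_le hγ0.le hγ' j
          _ = _ := mul_one _
      rw [hP4] at hq
      rw [le_div_iff₀ (by positivity)]
      calc _ = ε ^ 2 * numButterflies E * (12 * maxButterfliesPerEdge E /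
            (ε ^ 2 * numButterflies E) * l * (1 + j * (1 / 2))) := by
            field_simp
        _ ≤ _ := mul_le_mul_of_nonneg_left hq (by positivity))
    have hover : bernoulliExp (γ ^ N) E (overflow M) ≤ Real.exp (-l) := by
      refine (bernoulliExp_overflow_le (pow_nonneg hγ0.le _) (pow_le_one₀ hγ0.le hγ1.le) M E).trans
        (Real.exp_le_exp.2 ?_)
      have hq : γ ^ N ≤ 2 * P := by
        have : γ ^ N * (1 / 2) ≤ γ ^ (N + 1) := by
          rw [pow_succ]
          gcongr
        linarith
      have hc : (E.card : ℝ) * γ ^ N ≤ t * (2 * P) := by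
        gcongr
      -- Counting butterflies by edges gives `B ≤ t h`, so the factor `12 t h / (ε² B)` is at least
      -- `1`.
      have hlP : l ≤ t * P ^ 4 := by
        have : t * (12 * maxButterfliesPerEdge E / (ε ^ 2 * numButterflies E) * l) =
            l * (12 * (t * maxButterfliesPerEdge E) / (ε ^ 2 * numButterflies E)) := by ring
        rw [hP4, this]
        refine le_mul_of_one_le_right hl0.le ((one_le_div (by positivity)).2 ?_)
        have : ε ^ 2 ≤ 1 := pow_le_one₀ hε.le hε1
        nlinarith
      have hPP : P ^ 4 ≤ P := pow_le_of_le_one hP.le hP1.le (by norm_num)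
      have htP : (t : ℝ) * P ^ 4 ≤ t * P := by gcongr
      have hM0 : (0 : ℝ) ≤ M := Nat.cast_nonneg _
      -- The exponent is at most `2tP - 6tP log 2`, and `6 log 2 > 3` makes this at most `-tP ≤ -l`.
      have := Real.log_two_gt_d9
      nlinarith
    linarith

end Fleet

end

/-- `B` is the number of butterflies and `h` the maximum number of butterflies per edge after `t`
edges. The event contains the outcome `none`: running forever counts as a failure of ADA. -/
theorem mainTheorem4 {L R : Type*} [DecidableEq L] [DecidableEq R]
    (e : ℕ → L × R) (t : ℕ) (he : Set.InjOn e (Set.Iio t))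
    (B h : ℕ) (hB : B = Fleet.numButterflies (Fleet.streamGraph e t))
    (hh : h = Fleet.maxButterfliesPerEdge (Fleet.streamGraph e t))
    (hBpos : 0 < B)
    (M : ℕ) (γ : unitInterval) (hγ : (1 / 2 : ℝ) ≤ (γ : ℝ)) (hγ' : (γ : ℝ) ≤ 0.9)
    (ε δ : ℝ) (hε : ε ∈ Set.Ioo (0 : ℝ) 1) (hδ : δ ∈ Set.Ioo (0 : ℝ) 1)
    (hM : 6 * (t : ℝ) * ((12 * (h : ℝ) / (ε ^ 2 * (B : ℝ))) *
      Real.log (8 * (h : ℝ) * (4 + δ) / δ)) ^ (1 / 4 : ℝ) ≤ (M : ℝ)) :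
    (Fleet.adaEstimate M γ e t).toOuterMeasure
      {o : Option ℝ | ∀ Y ∈ o, ε * (B : ℝ) ≤ |Y - (B : ℝ)|} ≤ ENNReal.ofReal δ := by
  obtain ⟨hε0, hε1⟩ := hε
  obtain ⟨hδ0, hδ1⟩ := hδ
  have hcard : (Fleet.streamGraph e t).card ≤ t :=
    Finset.card_image_le.trans_eq (Finset.card_range t)
  have hh1 : 1 ≤ h := by
    have := Fleet.numButterflies_le (Fleet.streamGraph e t)
    rw [← hB, ← hh] at this
    exact Nat.pos_of_mul_pos_left (hBpos.trans_le this)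
  have hh1' : (1 : ℝ) ≤ h := by exact_mod_cast hh1
  have hBpos' : (0 : ℝ) < B := Nat.cast_pos.2 hBpos
  set l := Real.log (8 * (h : ℝ) * (4 + δ) / δ) with hl
  -- `exp (-l) = δ / (8h(4 + δ))` with `h ≥ 1`. The final step only needs `5 * exp (-l) ≤ δ`.
  have hexp : Real.exp (-l) ≤ δ / 32 := by
    rw [Real.exp_neg, hl, Real.exp_log (by positivity), inv_div, div_le_div_iff_of_pos_left hδ0
      (by positivity) (by norm_num)]
    nlinarith
  have hl0 : 0 < l := by
    by_contra! hn
    have := Real.one_le_exp (neg_nonneg.2 hn)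
    linarith
  set Q := 12 * (h : ℝ) / (ε ^ 2 * (B : ℝ)) * l with hQ
  have hQ0 : 0 < Q := by positivity
  have hQ4 : (Q ^ (1 / 4 : ℝ)) ^ 4 = Q := by
    rw [← Real.rpow_natCast, ← Real.rpow_mul hQ0.le]
    norm_num
  subst hB hh
  obtain ⟨N, hN⟩ := Fleet.sampling_failure_le hcard hBpos hγ hγ' hε0 hε1.le (l := l) (by linarith)
    (Real.rpow_pos_of_pos hQ0 _) hQ4 hM
  exact (Fleet.adaEstimate_deviation_le e t he M N γ _).trans
    (ENNReal.ofReal_le_ofReal (hN.trans (by linarith)))
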